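/- A real tree is a nonempty metric space $(T,d)$ such that (i) for all $x,y\in T$ there is a unique isometric embedding $\varphi_{x,y}:[0,d(x,y)]\to T$ with $\varphi_{x,y}(0)=x$ and $\varphi_{x,y}(d(x,y))=y$; its image is denoted $[x,y]$; and (ii) for every injective continuous map $\psi:[0,1]\to T$, $\psi([0,1])=[\psi(0),\psi(1)]$. (Completeness of $T$ is not assumed.) **Theorem.** If $T$ is a real tree, then its metric completion $\tilde T$ is a real tree. -/

import Mathlib

/-- `φ` is an isometric embedding of the closed interval `[0, d(x, y)] ⊆ ℝ` into `T` with
`φ(0) = x` and `φ(d(x, y)) = y`. -/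
def IsGeodesicFromTo {T : Type*} [MetricSpace T] (x y : T)
    (φ : Set.Icc (0 : ℝ) (dist x y) → T) : Prop :=
  Isometry φ ∧
    φ ⟨0, Set.left_mem_Icc.mpr dist_nonneg⟩ = x ∧
    φ ⟨dist x y, Set.right_mem_Icc.mpr dist_nonneg⟩ = y

/-- The segment `[x, y]`: the set of points on an isometric copy of `[0, d(x, y)]` from `x` to `y`.
When there is exactly one such isometric embedding, this is its image. -/
def geodesicSegment {T : Type*} [MetricSpace T] (x y : T) : Set T :=
  {z | ∃ φ : Set.Icc (0 : ℝ) (dist x y) → T, IsGeodesicFromTo x y φ ∧ z ∈ Set.range φ}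

/-- A real tree: a nonempty metric space in which any two points `x, y` are joined by a unique
isometric embedding of `[0, d(x, y)]`, and in which every injective continuous path
`ψ : [0, 1] → T` has the segment `[ψ(0), ψ(1)]` as its image. Completeness is not assumed. -/
structure IsRealTree (T : Type*) [MetricSpace T] : Prop where
  nonempty : Nonempty T
  existsUnique_geodesic : ∀ x y : T,
    ∃! φ : Set.Icc (0 : ℝ) (dist x y) → T, IsGeodesicFromTo x y φ
  range_eq_segment : ∀ ψ : Set.Icc (0 : ℝ) 1 → T, Continuous ψ → Function.Injective ψ →
    Set.range ψ = geodesicSegment (ψ 0) (ψ 1)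

open Set Filter Topology

/-! Neither axiom visibly survives limits, but a real tree satisfies the four-point inequality,
which is closed in the distances and so passes to the completion. Together with points at every
position between two given ones, it characterises real trees. Such points exist in the completion:
those of `T` supply approximations, which the inequality forces to be Cauchy (`dist_le_of_approx`).
Conversely, it makes a point between two others unique at its position and unavoidable for connected
sets joining them. -/

/-- The four-point condition (`0`-hyperbolicity in the sense of Gromov). -/
def FourPointCondition (X : Type*) [MetricSpace X] : Prop :=
  ∀ p x y z : X, dist x z + dist p y ≤ max (dist x y + dist p z) (dist y z + dist p x)

/-- Any point of a segment is metrically between its endpoints. -/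
theorem dist_add_dist_of_mem_geodesicSegment {X : Type*} [MetricSpace X] {x y z : X}
    (h : z ∈ geodesicSegment x y) : dist x z + dist z y = dist x y := by
  obtain ⟨φ, ⟨hφ, h0, h1⟩, ⟨t, ht⟩, rfl⟩ := h
  have e0 := hφ.dist_eq ⟨0, left_mem_Icc.mpr dist_nonneg⟩ ⟨t, ht⟩
  have e1 := hφ.dist_eq ⟨t, ht⟩ ⟨dist x y, right_mem_Icc.mpr dist_nonneg⟩
  rw [h0] at e0
  rw [h1] at e1
  rw [e0, e1, Subtype.dist_eq, Subtype.dist_eq, Real.dist_eq, Real.dist_eq,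
    abs_of_nonpos (by simpa using ht.1), abs_of_nonpos (by simpa using ht.2)]
  ring

/-! ### Real trees are 0-hyperbolic. -/

namespace IsRealTree

variable {T : Type*} [MetricSpace T]

/-- Geodesics, as continuous functions on the whole line. -/
theorem exists_geodesic (hT : IsRealTree T) (x y : T) :
    ∃ γ : ℝ → T, Continuous γ ∧ γ 0 = x ∧ γ (dist x y) = y ∧
      ∀ s ∈ Icc 0 (dist x y), ∀ t ∈ Icc 0 (dist x y), dist (γ s) (γ t) = |s - t| := by
  obtain ⟨φ, ⟨hφ, h0, h1⟩, -⟩ := hT.existsUnique_geodesic x y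
  refine ⟨IccExtend dist_nonneg φ, hφ.continuous.Icc_extend', ?_, ?_, ?_⟩
  · rw [IccExtend_left]; exact h0
  · rw [IccExtend_right]; exact h1
  · intro s hs t ht
    rw [IccExtend_of_mem _ _ hs, IccExtend_of_mem _ _ ht, hφ.dist_eq]
    rfl

theorem geodesic_unique (hT : IsRealTree T) {γ γ' : ℝ → T} {L : ℝ}
    (hγ : ∀ s ∈ Icc 0 L, ∀ t ∈ Icc 0 L, dist (γ s) (γ t) = |s - t|)
    (hγ' : ∀ s ∈ Icc 0 L, ∀ t ∈ Icc 0 L, dist (γ' s) (γ' t) = |s - t|)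
    (h0 : γ 0 = γ' 0) (h1 : γ L = γ' L) : EqOn γ γ' (Icc 0 L) := by
  intro t ht
  have hL : 0 ≤ L := ht.1.trans ht.2
  have hd : dist (γ 0) (γ L) = L := by
    rw [hγ 0 ⟨le_rfl, hL⟩ L ⟨hL, le_rfl⟩, zero_sub, abs_neg, abs_of_nonneg hL]
  have mem : ∀ {a}, a ∈ Icc 0 (dist (γ 0) (γ L)) → a ∈ Icc 0 L := fun h =>
    ⟨h.1, h.2.trans hd.le⟩
  have key := (hT.existsUnique_geodesic (γ 0) (γ L)).unique
    (y₁ := fun t => γ t) (y₂ := fun t => γ' t)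
    ⟨Isometry.of_dist_eq fun a b => hγ a (mem a.2) b (mem b.2), rfl, congrArg γ hd⟩
    ⟨Isometry.of_dist_eq fun a b => hγ' a (mem a.2) b (mem b.2), h0.symm,
      (congrArg γ' hd).trans h1.symm⟩
  exact congrFun key ⟨t, by rwa [hd]⟩

/-- Points of an arc are metrically between its endpoints. -/
theorem dist_add_dist_of_injOn (hT : IsRealTree T) {η : ℝ → T} {a b : ℝ} (hab : a < b)
    (hc : Continuous η) (hi : InjOn η (Icc a b)) {s : ℝ} (hs : s ∈ Icc a b) :
    dist (η a) (η s) + dist (η s) (η b) = dist (η a) (η b) := by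
  have hba : 0 < b - a := sub_pos.2 hab
  have hmem : ∀ t : Icc (0 : ℝ) 1, a + (b - a) * t ∈ Icc a b := fun t =>
    ⟨by nlinarith [t.2.1], by nlinarith [t.2.2]⟩
  have hr := hT.range_eq_segment (fun t => η (a + (b - a) * t)) (by fun_prop) (by
    intro t u htu
    have := hi (hmem t) (hmem u) htu
    exact Subtype.ext (mul_left_cancel₀ hba.ne' (add_left_cancel this)))
  simp only [Icc.coe_zero, Icc.coe_one, mul_zero, add_zero, mul_one, add_sub_cancel] at hr
  refine dist_add_dist_of_mem_geodesicSegment (hr ▸ ⟨⟨(s - a) / (b - a), ?_, ?_⟩, ?_⟩)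
  · exact div_nonneg (by linarith [hs.1]) hba.le
  · exact (div_le_one hba).2 (by linarith [hs.2])
  · simp only
    rw [mul_div_cancel₀ _ hba.ne', add_sub_cancel]

/-- Two geodesics from `p` agree exactly up to the Gromov product of their endpoints. -/
theorem exists_branch_point (hT : IsRealTree T) {p x y : T} {γ γ' : ℝ → T}
    (hc : Continuous γ) (hc' : Continuous γ') (h0 : γ 0 = p) (h0' : γ' 0 = p)
    (h1 : γ (dist p x) = x) (h1' : γ' (dist p y) = y)
    (hγ : ∀ s ∈ Icc 0 (dist p x), ∀ t ∈ Icc 0 (dist p x), dist (γ s) (γ t) = |s - t|)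
    (hγ' : ∀ s ∈ Icc 0 (dist p y), ∀ t ∈ Icc 0 (dist p y), dist (γ' s) (γ' t) = |s - t|) :
    ∃ r ∈ Icc 0 (min (dist p x) (dist p y)), EqOn γ γ' (Icc 0 r) ∧
      (∀ t ∈ Icc 0 (min (dist p x) (dist p y)), γ t = γ' t → t ≤ r) ∧
      dist x y = dist p x + dist p y - 2 * r := by
  set M := min (dist p x) (dist p y) with hM
  have hM0 : 0 ≤ M := le_min dist_nonneg dist_nonneg
  have hMx : M ≤ dist p x := min_le_left _ _
  have hMy : M ≤ dist p y := min_le_right _ _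
  have hcomp : IsCompact (Icc 0 M ∩ {t | γ t = γ' t}) :=
    isCompact_Icc.inter_right (isClosed_eq hc hc')
  obtain ⟨r, ⟨hr, hre⟩, hmax⟩ := hcomp.exists_isGreatest ⟨0, ⟨le_rfl, hM0⟩, h0.trans h0'.symm⟩
  have hmax' : ∀ t ∈ Icc 0 M, γ t = γ' t → t ≤ r := fun t ht h => hmax ⟨ht, h⟩
  refine ⟨r, hr, ?_, hmax', ?_⟩
  · exact hT.geodesic_unique
      (fun s hs t ht => hγ s ⟨hs.1, by linarith [hs.2, hr.2]⟩ t ⟨ht.1, by linarith [ht.2, hr.2]⟩)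
      (fun s hs t ht => hγ' s ⟨hs.1, by linarith [hs.2, hr.2]⟩ t ⟨ht.1, by linarith [ht.2, hr.2]⟩)
      (h0.trans h0'.symm) hre
  have dist_p : ∀ t ∈ Icc 0 (dist p x), dist p (γ t) = t := fun t ht => by
    have := hγ 0 ⟨le_rfl, dist_nonneg⟩ t ht
    rwa [h0, zero_sub, abs_neg, abs_of_nonneg ht.1] at this
  have dist_p' : ∀ t ∈ Icc 0 (dist p y), dist p (γ' t) = t := fun t ht => by
    have := hγ' 0 ⟨le_rfl, dist_nonneg⟩ t ht
    rwa [h0', zero_sub, abs_neg, abs_of_nonneg ht.1] at this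
  have hrx : r ∈ Icc 0 (dist p x) := ⟨hr.1, hr.2.trans hMx⟩
  have hry : r ∈ Icc 0 (dist p y) := ⟨hr.1, hr.2.trans hMy⟩
  have hxm : dist x (γ r) = dist p x - r := by
    have := hγ (dist p x) ⟨dist_nonneg, le_rfl⟩ r hrx
    rwa [h1, abs_of_nonneg (sub_nonneg.2 hrx.2)] at this
  have hmy : dist (γ r) y = dist p y - r := by
    have := hγ' (dist p y) ⟨dist_nonneg, le_rfl⟩ r hry
    rwa [h1', abs_of_nonneg (sub_nonneg.2 hry.2), dist_comm, ← show γ r = γ' r from hre] at this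
  suffices h : dist x (γ r) + dist (γ r) y = dist x y by linarith
  -- If the branch point is `x`, the claim is trivial; otherwise the domain of the arc below is
  -- nondegenerate.
  rcases hrx.2.eq_or_lt with hx | hx
  · have : γ r = x := by rw [hx, h1]
    rw [this, dist_self, zero_add]
  -- The path goes from `x` back to the branch point, reached at time `0`, then on to `y`. It is
  -- injective: equal points are equidistant from `p`, and `r` is the last time of agreement.
  set η : ℝ → T := fun s => if s ≤ 0 then γ (r - s) else γ' (r + s) with hη
  have hηc : Continuous η := Continuous.if_le (by fun_prop) (by fun_prop) (by fun_prop)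
    (by fun_prop) (by rintro s rfl; simpa using hre)
  have hneg : ∀ s ≤ 0, η s = γ (r - s) := fun s hs => if_pos hs
  have hpos : ∀ s, 0 < s → η s = γ' (r + s) := fun s hs => if_neg hs.not_ge
  have hcross : ∀ s ∈ Icc (r - dist p x) (dist p y - r), ∀ t ∈ Icc (r - dist p x) (dist p y - r),
      s ≤ 0 → 0 < t → η s ≠ η t := by
    intro s hs t ht hs0 ht0 he
    rw [hneg s hs0, hpos t ht0] at he
    have m1 : r - s ∈ Icc 0 (dist p x) := ⟨by linarith [hr.1], by linarith [hs.1]⟩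
    have m2 : r + t ∈ Icc 0 (dist p y) := ⟨by linarith [hr.1], by linarith [ht.2]⟩
    have e : r - s = r + t := by rw [← dist_p _ m1, he, dist_p' _ m2]
    have := hmax' (r + t) ⟨m2.1, le_min (e ▸ m1.2) m2.2⟩ (e ▸ he)
    linarith
  have hinj : InjOn η (Icc (r - dist p x) (dist p y - r)) := by
    intro s hs t ht he
    rcases le_or_gt s 0 with hs0 | hs0 <;> rcases le_or_gt t 0 with ht0 | ht0
    · rw [hneg s hs0, hneg t ht0] at he
      have m1 : r - s ∈ Icc 0 (dist p x) := ⟨by linarith [hr.1], by linarith [hs.1]⟩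
      have m2 : r - t ∈ Icc 0 (dist p x) := ⟨by linarith [hr.1], by linarith [ht.1]⟩
      have e : r - s = r - t := by rw [← dist_p _ m1, he, dist_p _ m2]
      linarith
    · exact absurd he (hcross s hs t ht hs0 ht0)
    · exact absurd he.symm (hcross t ht s hs ht0 hs0)
    · rw [hpos s hs0, hpos t ht0] at he
      have m1 : r + s ∈ Icc 0 (dist p y) := ⟨by linarith [hr.1], by linarith [hs.2]⟩
      have m2 : r + t ∈ Icc 0 (dist p y) := ⟨by linarith [hr.1], by linarith [ht.2]⟩
      have e : r + s = r + t := by rw [← dist_p' _ m1, he, dist_p' _ m2]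
      linarith
  have hle : 0 ≤ dist p y - r := sub_nonneg.2 hry.2
  have key := hT.dist_add_dist_of_injOn (by linarith) hηc hinj (s := 0) ⟨by linarith, hle⟩
  have ea : η (r - dist p x) = x := by
    rw [hneg _ (by linarith), sub_sub_cancel, h1]
  have eb : η (dist p y - r) = y := by
    rcases hle.eq_or_lt with h | h
    · rw [← h, hneg 0 le_rfl, sub_zero, show γ r = γ' r from hre, sub_eq_zero.1 h.symm |>.symm, h1']
    · rw [hpos _ h, add_sub_cancel, h1']
  rwa [ea, eb, hneg 0 le_rfl, sub_zero] at key

/-- In terms of Gromov products at `p` this reads `min r s ≤ t`: up to time `min r s` all three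
geodesics coincide. -/
theorem fourPointCondition (hT : IsRealTree T) : FourPointCondition T := by
  intro p x y z
  obtain ⟨α, cα, α0, α1, hα⟩ := hT.exists_geodesic p x
  obtain ⟨β, cβ, β0, β1, hβ⟩ := hT.exists_geodesic p y
  obtain ⟨γ, cγ, γ0, γ1, hγ⟩ := hT.exists_geodesic p z
  obtain ⟨r, hr, er, -, dr⟩ := hT.exists_branch_point cα cβ α0 β0 α1 β1 hα hβ
  obtain ⟨s, hs, es, -, ds⟩ := hT.exists_branch_point cβ cγ β0 γ0 β1 γ1 hβ hγ
  obtain ⟨t, -, -, ht, dt⟩ := hT.exists_branch_point cα cγ α0 γ0 α1 γ1 hα hγ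
  have h0 : 0 ≤ min r s := le_min hr.1 hs.1
  have key : min r s ≤ t := ht _
    ⟨h0, le_min ((min_le_left r s).trans (hr.2.trans (min_le_left _ _)))
      ((min_le_right r s).trans (hs.2.trans (min_le_right _ _)))⟩
    ((er ⟨h0, min_le_left _ _⟩).trans (es ⟨h0, min_le_right _ _⟩))
  rcases min_le_iff.1 key with h | h
  · exact le_max_of_le_left (by linarith)
  · exact le_max_of_le_right (by linarith)

end IsRealTree

/-! ### Consequences of the four-point condition. -/

namespace FourPointCondition

variable {X : Type*} [MetricSpace X]

theorem completion (h : FourPointCondition X) :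
    FourPointCondition (UniformSpace.Completion X) := by
  intro p x y z
  induction p, x using UniformSpace.Completion.induction_on₂ with
  | hp => exact isClosed_le (by fun_prop) (by fun_prop)
  | ih p x =>
    induction y, z using UniformSpace.Completion.induction_on₂ with
    | hp => exact isClosed_le (by fun_prop) (by fun_prop)
    | ih y z => simpa only [UniformSpace.Completion.dist_eq] using h p x y z

/-- Two points with almost the same position between `x` and `y` are close. -/
theorem dist_le_of_approx (h : FourPointCondition X) {x y z w : X} {t u δ ε : ℝ}
    (hz : dist x z ≤ t + δ) (hz' : dist z y ≤ dist x y - t + δ)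
    (hw : dist x w ≤ u + ε) (hw' : dist w y ≤ dist x y - u + ε) :
    dist z w ≤ |t - u| + δ + ε := by
  have := h x z y w
  rw [dist_comm y w] at this
  rcases le_max_iff.1 this with h | h
  · linarith [neg_abs_le (t - u)]
  · linarith [le_abs_self (t - u)]

theorem exists_between [CompleteSpace X] (h : FourPointCondition X) {x y : X} {t : ℝ}
    (happrox : ∀ ε > 0, ∃ z, dist x z ≤ t + ε ∧ dist z y ≤ dist x y - t + ε) :
    ∃ z, dist x z = t ∧ dist z y = dist x y - t := by
  choose z hz hz' using fun n : ℕ => happrox (1 / ((n : ℝ) + 1)) Nat.one_div_pos_of_nat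
  have hlim := tendsto_one_div_add_atTop_nhds_zero_nat (𝕜 := ℝ)
  have hcauchy : CauchySeq z := by
    refine cauchySeq_of_le_tendsto_0 (fun N : ℕ => 1 / ((N : ℝ) + 1) + 1 / ((N : ℝ) + 1)) ?_
      (by simpa using hlim.add hlim)
    intro n m N hn hm
    have := h.dist_le_of_approx (hz n) (hz' n) (hz m) (hz' m)
    rw [sub_self, abs_zero, zero_add] at this
    exact this.trans
      (add_le_add (Nat.one_div_le_one_div hn) (Nat.one_div_le_one_div hm))
  obtain ⟨w, hw⟩ := cauchySeq_tendsto_of_complete hcauchy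
  have h1 : dist x w ≤ t + 0 :=
    le_of_tendsto_of_tendsto' (tendsto_const_nhds.dist hw) (tendsto_const_nhds.add hlim) hz
  have h2 : dist w y ≤ dist x y - t + 0 :=
    le_of_tendsto_of_tendsto' (hw.dist tendsto_const_nhds) (tendsto_const_nhds.add hlim) hz'
  have := dist_triangle x w y
  exact ⟨w, by linarith, by linarith⟩

theorem eq_of_between (h : FourPointCondition X) {x y z w : X}
    (hz : dist x z + dist z y = dist x y) (hw : dist x w + dist w y = dist x y)
    (hd : dist x z = dist x w) : z = w := by
  have := h.dist_le_of_approx (x := x) (y := y) (z := z) (w := w) (t := dist x z) (u := dist x z)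
    (δ := 0) (ε := 0) (by linarith) (by linarith) (by linarith) (by linarith)
  simp only [sub_self, abs_zero, add_zero] at this
  exact dist_le_zero.1 this

/-- Removing a point strictly between `x` and `y` disconnects `x` from `y`. -/
theorem mem_of_isPreconnected (h : FourPointCondition X) {A : Set X} (hA : IsPreconnected A)
    {x y z : X} (hx : x ∈ A) (hy : y ∈ A) (hz : dist x z + dist z y = dist x y) : z ∈ A := by
  by_contra hzA
  have hne : ∀ u ∈ A, 0 < dist z u := fun u hu =>
    dist_pos.2 fun e => hzA (e ▸ hu)
  -- `V` gathers the points joined, without passing `z`, to some `v` lying behind `z` as seen from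
  -- `x`; this form makes `V` open. The four-point condition at `z, x, u, v` makes `U` and `V`
  -- disjoint.
  let U : Set X := {u | dist x u < dist x z + dist z u}
  let V : Set X := {u | ∃ v, dist x v = dist x z + dist z v ∧ dist v u < dist z v + dist z u}
  have hU : IsOpen U := isOpen_lt (by fun_prop) (by fun_prop)
  have hV : IsOpen V := by
    have : V = ⋃ v ∈ {v | dist x v = dist x z + dist z v},
        {u | dist v u < dist z v + dist z u} := by ext; simp [V]
    rw [this]
    exact isOpen_biUnion fun v _ => isOpen_lt (by fun_prop) (by fun_prop)
  obtain ⟨u, huA, huU, v, hv, hvu⟩ := hA U V hU hV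
    (by
      intro u hu
      rcases (dist_triangle x z u).lt_or_eq with hlt | heq
      · exact Or.inl hlt
      · exact Or.inr ⟨u, heq, by rw [dist_self]; linarith [hne u hu]⟩)
    ⟨x, hx, by
      change dist x x < dist x z + dist z x
      rw [dist_self, dist_comm x z]; linarith [hne x hx]⟩
    ⟨y, hy, y, hz.symm, by rw [dist_self]; linarith [hne y hy]⟩
  have huU : dist x u < dist x z + dist z u := huU
  have := h z x u v
  rw [dist_comm u v, dist_comm z x] at this
  rcases le_max_iff.1 this with h' | h' <;> linarith

end FourPointCondition

/-- A metric space satisfying the four-point condition and having a point at each position between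
any two points is a real tree. -/
theorem FourPointCondition.isRealTree {X : Type*} [MetricSpace X] [Nonempty X]
    (h : FourPointCondition X)
    (hb : ∀ x y : X, ∀ t ∈ Icc 0 (dist x y), ∃ z, dist x z = t ∧ dist z y = dist x y - t) :
    IsRealTree X := by
  have hgeo : ∀ x y : X, ∃ φ : Icc (0 : ℝ) (dist x y) → X, IsGeodesicFromTo x y φ := by
    intro x y
    choose φ h1 h2 using fun t : Icc (0 : ℝ) (dist x y) => hb x y t t.2
    refine ⟨φ, Isometry.of_dist_eq fun s t => ?_, ?_, ?_⟩
    · rw [Subtype.dist_eq, Real.dist_eq]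
      refine le_antisymm ?_ (abs_le.2 ⟨?_, ?_⟩)
      · have := h.dist_le_of_approx (δ := 0) (ε := 0) ((h1 s).trans (add_zero _).symm).le
          ((h2 s).trans (add_zero _).symm).le ((h1 t).trans (add_zero _).symm).le
          ((h2 t).trans (add_zero _).symm).le
        simpa using this
      · linarith [dist_triangle x (φ s) (φ t), h1 s, h1 t]
      · linarith [dist_triangle x (φ t) (φ s), h1 s, h1 t, dist_comm (φ s) (φ t)]
    · exact (dist_eq_zero.1 (h1 _)).symm
    · exact dist_eq_zero.1 ((h2 _).trans (sub_self _))
  have hpos : ∀ {x y : X} {φ : Icc (0 : ℝ) (dist x y) → X}, IsGeodesicFromTo x y φ →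
      ∀ t, dist x (φ t) = t := by
    intro x y φ hφ t
    have := hφ.1.dist_eq ⟨0, left_mem_Icc.mpr dist_nonneg⟩ t
    rwa [hφ.2.1, Subtype.dist_eq, Real.dist_eq, zero_sub, abs_neg, abs_of_nonneg t.2.1] at this
  have hbet : ∀ {x y : X} {φ : Icc (0 : ℝ) (dist x y) → X}, IsGeodesicFromTo x y φ →
      ∀ t, dist x (φ t) + dist (φ t) y = dist x y := fun hφ t =>
    dist_add_dist_of_mem_geodesicSegment ⟨_, hφ, mem_range_self t⟩
  have hseg : ∀ {x y z : X}, dist x z + dist z y = dist x y → z ∈ geodesicSegment x y := by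
    intro x y z hz
    obtain ⟨φ, hφ⟩ := hgeo x y
    let t : Icc (0 : ℝ) (dist x y) :=
      ⟨dist x z, dist_nonneg, by linarith [dist_nonneg (x := z) (y := y)]⟩
    exact ⟨φ, hφ, t, h.eq_of_between (hbet hφ t) hz (hpos hφ t)⟩
  refine ⟨inferInstance, fun x y => ?_, fun ψ hc hi => ?_⟩
  · obtain ⟨φ, hφ⟩ := hgeo x y
    exact ⟨φ, hφ, fun φ' hφ' => funext fun t =>
      h.eq_of_between (hbet hφ' t) (hbet hφ t) ((hpos hφ' t).trans (hpos hφ t).symm)⟩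
  refine Subset.antisymm ?_ fun z hz => ?_
  · rintro _ ⟨s, rfl⟩
    -- The geodesics from `ψ s` to both ends agree up to the Gromov product, which thus vanishes.
    set x := ψ 0
    set y := ψ 1
    set p := ψ s
    set r := (dist p x + dist p y - dist x y) / 2 with hr
    have hr0 : 0 ≤ r := by linarith [dist_triangle_left x y p]
    have hrx : r ≤ dist p x := by linarith [dist_triangle p x y]
    have hry : r ≤ dist p y := by linarith [dist_triangle p y x, dist_comm x y]
    obtain ⟨u, hu, hu'⟩ := hb p x r ⟨hr0, hrx⟩
    obtain ⟨v, hv, hv'⟩ := hb p y r ⟨hr0, hry⟩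
    have huv : u = v := by
      -- The first inequality yields `dist u y ≤ dist p y - r`, and the second then `dist u v ≤ 0`.
      have e1 := h p u x y
      have e2 := h p u y v
      rw [dist_comm y v] at e2
      refine dist_le_zero.1 ?_
      rcases le_max_iff.1 e1 with e1 | e1 <;> rcases le_max_iff.1 e2 with e2 | e2 <;> linarith
    subst huv
    -- The path meets `u` both up to time `s` and from `s` on, so injectivity gives `u = ψ s`.
    have m1 : u ∈ ψ '' Iic s := h.mem_of_isPreconnected
      (isPreconnected_Iic.image ψ hc.continuousOn) ⟨s, self_mem_Iic, rfl⟩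
      ⟨0, s.2.1, rfl⟩ (show dist p u + dist u x = dist p x by linarith)
    have m2 : u ∈ ψ '' Ici s := h.mem_of_isPreconnected
      (isPreconnected_Ici.image ψ hc.continuousOn) ⟨s, self_mem_Ici, rfl⟩
      ⟨1, s.2.2, rfl⟩ (show dist p u + dist u y = dist p y by linarith)
    obtain ⟨a, ha, rfl⟩ := m1
    obtain ⟨b, hb, hab⟩ := m2
    have has : a = s := le_antisymm ha (hi hab ▸ hb)
    have hr00 : r = 0 := by rw [← hu, has, dist_self]
    exact hseg (by linarith [dist_comm p x])
  · exact h.mem_of_isPreconnected (isPreconnected_range hc) (mem_range_self _) (mem_range_self _)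
      (dist_add_dist_of_mem_geodesicSegment hz)

theorem IsRealTree.exists_approx_completion {T : Type*} [MetricSpace T] (hT : IsRealTree T)
    (x y : UniformSpace.Completion T) {t : ℝ} (ht : t ∈ Icc 0 (dist x y)) {ε : ℝ} (hε : 0 < ε) :
    ∃ z, dist x z ≤ t + ε ∧ dist z y ≤ dist x y - t + ε := by
  have hdense := UniformSpace.Completion.denseRange_coe (α := T)
  obtain ⟨x', hx'⟩ := hdense.exists_dist_lt x (by positivity : 0 < ε / 3)
  obtain ⟨y', hy'⟩ := hdense.exists_dist_lt y (by positivity : 0 < ε / 3)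
  obtain ⟨γ, -, h0, h1, hγ⟩ := hT.exists_geodesic x' y'
  have hd := UniformSpace.Completion.dist_eq x' y'
  -- `t` may exceed `dist x' y'`, hence the truncation. Of the three errors `ε / 3`, two come from
  -- comparing `dist x' y'` with `dist x y` and one from passing from `y'` to `y`.
  set u := min t (dist x' y') with hu
  have hmem : u ∈ Icc 0 (dist x' y') := ⟨le_min ht.1 dist_nonneg, min_le_right _ _⟩
  have e0 := hγ 0 ⟨le_rfl, dist_nonneg⟩ u hmem
  have e1 := hγ u hmem _ ⟨dist_nonneg, le_rfl⟩
  rw [h0, zero_sub, abs_neg, abs_of_nonneg hmem.1, ← UniformSpace.Completion.dist_eq] at e0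
  rw [h1, abs_of_nonpos (sub_nonpos.2 hmem.2), ← UniformSpace.Completion.dist_eq] at e1
  have hut : u ≤ t := min_le_left _ _
  refine ⟨(γ u : T), ?_, ?_⟩
  · linarith [dist_triangle x (x' : UniformSpace.Completion T) (γ u : T)]
  · have a1 := dist_triangle ((γ u : T) : UniformSpace.Completion T) y' y
    have a2 := dist_triangle4 (x' : UniformSpace.Completion T) x y y'
    rw [dist_comm _ x] at a2
    rw [dist_comm (y' : UniformSpace.Completion T) y] at a1
    rcases min_choice t (dist x' y') with h | h
    · linarith [hu.trans h]
    · linarith [hu.trans h, ht.2]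

theorem theorem6p5 (T : Type*) [MetricSpace T] (hT : IsRealTree T) :
    IsRealTree (UniformSpace.Completion T) := by
  have : Nonempty (UniformSpace.Completion T) := hT.nonempty.map (↑)
  have h := hT.fourPointCondition.completion
  exact h.isRealTree fun x y t ht =>
    h.exists_between fun ε hε => hT.exists_approx_completion x y ht hε
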